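/- **Setting.** A *weighted set* is a finite set $I$ of items with weights $w_i>0$ for $i\in I$ (and $w_i=0$ for $i\notin I$). A *sampling scheme* for $I$ is a discrete probability distribution over weighted sets $(S,\hat w)$ with $S\subseteq I$; $S$ is the sample, $\hat w_i>0$ is the weight estimate of a sampled item $i\in S$, and $\hat w_i=0$ for $i\notin S$. For an integer $k\ge 1$ the *threshold* $\tau_k$ of $I$ is the unique $\tau>0$ with $\sum_{i\in I}\min\{1,w_i/\tau\}=k$ if $k<|I|$, and $\tau_k=0$ if $k\ge|I|$. Consider the following properties of a scheme. * *Unbiased:* $\mathrm{E}[\hat w_i]=w_i$ for all $i\in I$. * (i) *(ipps)* $\Pr[i\in S]=\min\{1,w_i/\tau_k\}$ for all $i\in I$ (read as $1$ if $\tau_k=0$), and each sampled item $i\in S$ gets the estimate $\hat w_i=\max\{w_i,\tau_k\}$. * (ii) $|S|\le k$. * (iii) $\mathrm{Cov}[\hat w_i,\hat w_j]$ exists and is $\le 0$ for all distinct $i,j\in I$. * (iii+) For every $J\subseteq I$, $\Pr[J\subseteq S]\le\prod_{i\in J}\Pr[i\in S]$ and $\Pr[J\cap S=\emptyset]\le\prod_{i\in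 J}\Pr[i\notin S]$. A *VarOpt$_k$ scheme* is an unbiased scheme that satisfies (i), (ii) and (iii) for $k$. Let $I_1,\dots,I_m$ be disjoint weighted sets and let $k\ge1$ and $k_1,\dots,k_m\ge k$ be integers. For each $x$ let a scheme for $I_x$ be given (the *inner subcalls*), and for every weighted set $v$ a scheme for $v$ (the *outer subcall* on input $v$). The *resulting call* is the following scheme for $I=\bigcup_x I_x$: run the inner subcalls independently of each other, let $I'$ be the union of their samples, weighted by their estimates, and, with independent random choices, run the outer subcall on $I'$, treating the estimates as weights; its sample and its estimates are the result. **Theorem.** Below, "the outer subcall has a property" means that it has this property on every input $I'$ that the inner subcalls produce with positive probability. 1. If all the subcalls are unbiased, then the resulting call is unbiased. 2. If all the subcalls are unbiased and satisfy (iii), then the resulting call satisfies (iii). 3. If each inner subcall satisfies (i) and (ii) with $k_x$ in place of $k$, and the outer subcall satisfies (i) for $k$, then the resulting call satisfies (i) for $k$. 4. If each inner subcall is a VarOpt$_{k_x}$ scheme and the outer subcall is a VarOpt$_k$ scheme, then the resulting call is a VarOpt$_k$ scheme. 5. If, in addition to the assumptions of 4, all the subcalls satisfy (iii+), then the resulting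 call is a VarOpt$_k$ scheme that satisfies (iii+). -/

import Mathlib

open MeasureTheory ProbabilityTheory

noncomputable section

namespace VarOpt

/-- A finite set of items, each with a positive weight. An item outside the set has the implicit
weight `0`. -/
@[ext]
structure WeightedSet (ι : Type*) where
  items : Finset ι
  weight : ι → ℝ
  weight_pos : ∀ i ∈ items, 0 < weight i
  weight_eq_zero : ∀ i, i ∉ items → weight i = 0

/-- All sets of weighted sets are events. -/
instance WeightedSet.instMeasurableSpace (ι : Type*) : MeasurableSpace (WeightedSet ι) := ⊤

theorem WeightedSet.weight_nonneg {ι : Type*} (I : WeightedSet ι) (i : ι) : 0 ≤ I.weight i := by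
  by_cases h : i ∈ I.items
  · exact (I.weight_pos i h).le
  · exact (I.weight_eq_zero i h).ge

/-- The union of a finite family of weighted sets. When the item sets are disjoint (the only case
that occurs below) every item keeps the weight that it has in the member containing it, because
all the other summands are `0`. -/
def WeightedSet.union {ι : Type*} [DecidableEq ι] {m : ℕ} (I : Fin m → WeightedSet ι) :
    WeightedSet ι where
  items := Finset.univ.biUnion fun x => (I x).items
  weight i := ∑ x, (I x).weight i
  weight_pos := by
    intro i hi
    obtain ⟨x, -, hx⟩ := Finset.mem_biUnion.mp hi
    exact Finset.sum_pos' (fun y _ => (I y).weight_nonneg i)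
      ⟨x, Finset.mem_univ x, (I x).weight_pos i hx⟩
  weight_eq_zero := by
    intro i hi
    refine Finset.sum_eq_zero fun x _ => (I x).weight_eq_zero i fun hx => hi ?_
    exact Finset.mem_biUnion.mpr ⟨x, Finset.mem_univ x, hx⟩

/-- A sampling and estimation scheme for the input `I`: a probability distribution over outcomes
`o`, where `o.items ⊆ I.items` is the sample and `o.weight i` is the weight estimate (adjusted
weight) of item `i`, which is `0` if `i` is not sampled. -/
structure Scheme {ι : Type*} (I : WeightedSet ι) where
  law : PMF (WeightedSet ι)
  subset : ∀ o ∈ law.support, o.items ⊆ I.items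

/-- `τ` is the threshold of `I` for capacity `k`. -/
def IsThreshold {ι : Type*} (k : ℕ) (I : WeightedSet ι) (τ : ℝ) : Prop :=
  (k < I.items.card ∧ 0 < τ ∧ ∑ i ∈ I.items, min 1 (I.weight i / τ) = k) ∨
    (I.items.card ≤ k ∧ τ = 0)

/-- The threshold probability `min {1, w / τ}`, which is `1` for `τ = 0`. -/
def thresholdProb (w τ : ℝ) : ℝ := if τ = 0 then 1 else min 1 (w / τ)

namespace Scheme

variable {ι : Type*} {I : WeightedSet ι}

/-- The probability that all the items of `J` are sampled. -/
def inclProb (A : Scheme I) (J : Finset ι) : ℝ := A.law.toMeasure.real {o | J ⊆ o.items}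

/-- The probability that none of the items of `J` is sampled. -/
def exclProb (A : Scheme I) (J : Finset ι) : ℝ := A.law.toMeasure.real {o | Disjoint J o.items}

/-- The weight estimates are unbiased. -/
def Unbiased (A : Scheme I) : Prop :=
  ∀ i ∈ I.items, Integrable (fun o => o.weight i) A.law.toMeasure ∧
    ∫ o, o.weight i ∂A.law.toMeasure = I.weight i

/-- (i): ipps threshold probabilities with Horvitz-Thompson estimates. -/
def Ipps (k : ℕ) (A : Scheme I) : Prop :=
  ∃ τ, IsThreshold k I τ ∧
    (∀ i ∈ I.items, A.inclProb {i} = thresholdProb (I.weight i) τ) ∧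
    ∀ o ∈ A.law.support, ∀ i ∈ o.items, o.weight i = max (I.weight i) τ

/-- (ii): at most `k` samples. -/
def AtMost (k : ℕ) (A : Scheme I) : Prop := ∀ o ∈ A.law.support, o.items.card ≤ k

/-- (iii): the covariances of distinct weight estimates exist and are not positive. -/
def NonposCov (A : Scheme I) : Prop :=
  ∀ i ∈ I.items, ∀ j ∈ I.items, i ≠ j →
    Integrable (fun o => o.weight i) A.law.toMeasure ∧
    Integrable (fun o => o.weight j) A.law.toMeasure ∧
    Integrable (fun o => o.weight i * o.weight j) A.law.toMeasure ∧
    cov[fun o => o.weight i, fun o => o.weight j; A.law.toMeasure] ≤ 0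

/-- (iii+): joint inclusion and exclusion probabilities are at most the products of the
marginals. -/
def HighOrder (A : Scheme I) : Prop :=
  ∀ J ⊆ I.items, A.inclProb J ≤ ∏ i ∈ J, A.inclProb {i} ∧
    A.exclProb J ≤ ∏ i ∈ J, A.exclProb {i}

/-- A `VarOpt_k` scheme: unbiased with (i), (ii) and (iii). -/
structure IsVarOpt (k : ℕ) (A : Scheme I) : Prop where
  unbiased : A.Unbiased
  ipps : A.Ipps k
  atMost : A.AtMost k
  nonposCov : A.NonposCov

/-- A `VarOpt_k` scheme with (iii+) in addition. -/
structure IsVarOptPlus (k : ℕ) (A : Scheme I) : Prop extends A.IsVarOpt k where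
  highOrder : A.HighOrder

end Scheme

theorem tsum_prod_eq_one {α : Type*} : ∀ {m : ℕ} (p : Fin m → PMF α),
    ∑' f : Fin m → α, ∏ x, p x (f x) = 1
  | 0, p => by simp
  | m + 1, p => by
    rw [← (Fin.consEquiv fun _ : Fin (m + 1) => α).tsum_eq, ENNReal.tsum_prod']
    simp [Fin.consEquiv, Fin.prod_univ_succ, ENNReal.tsum_mul_left,
      tsum_prod_eq_one fun x : Fin m => p x.succ, PMF.tsum_coe]

/-- The joint distribution of independent draws from `p 0, …, p (m - 1)`. -/
def indep {α : Type*} {m : ℕ} (p : Fin m → PMF α) : PMF (Fin m → α) :=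
  ⟨fun f => ∏ x, p x (f x), by
    have h := ENNReal.summable.hasSum (f := fun f : Fin m → α => ∏ x, p x (f x))
    rwa [tsum_prod_eq_one] at h⟩

section Recurrence

variable {ι : Type*} [DecidableEq ι] {m : ℕ} {I : Fin m → WeightedSet ι}

/-- The combined inner sampling: run the schemes `inner x` independently of each other and take
the union of the resulting samples with their adjusted weights. -/
def innerUnion (inner : ∀ x, Scheme (I x)) : Scheme (WeightedSet.union I) where
  law := (indep fun x => (inner x).law).map WeightedSet.union
  subset := by
    intro o ho
    obtain ⟨f, hf, rfl⟩ := (PMF.mem_support_map_iff _ _ _).mp ho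
    have hx : ∀ x, f x ∈ (inner x).law.support := fun x h0 =>
      hf (Finset.prod_eq_zero (Finset.mem_univ x) h0)
    exact Finset.biUnion_mono fun x _ => (inner x).subset (f x) (hx x)

/-- The resulting call: run the combined inner sampling, and then, with fresh randomness, the
outer scheme on its outcome, treating the adjusted weights as if they were original weights. -/
def resulting (inner : ∀ x, Scheme (I x)) (outer : ∀ v : WeightedSet ι, Scheme v) :
    Scheme (WeightedSet.union I) where
  law := (innerUnion inner).law.bind fun v => (outer v).law
  subset := by
    intro o ho
    obtain ⟨v, hv, hov⟩ := (PMF.mem_support_bind_iff _ _ _).mp ho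
    exact ((outer v).subset o hov).trans ((innerUnion inner).subset v hv)

end Recurrence

end VarOpt

end

/-!
Condition on the outcome `v` of the inner calls. Unbiasedness of the outer call is a tower
identity, and the bound `E[ŵ_i ŵ_j] ≤ w_i w_j`, which is (iii) for an unbiased scheme, passes
through the two stages one after the other; before that, independence factors the expectations
over the parts `I_x`.

For (i), let `τ` be the threshold of `I` and `σ_x ≤ τ` that of `I_x`. The inner call on `I_x` draws
a sample of constant size and raises every weight below `σ_x` to `σ_x`, which leaves
`∑ i, min {1, w_i / τ}` unchanged. Hence `τ` also acts as the threshold of every possible `v`, and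
the outer call samples `i ∈ v` with probability `max {w_i, σ_x} / max {w_i, τ}`, whatever the rest
of `v` is. Since these probabilities do not depend on `v`, sampling `i` in the resulting call is
sampling it in the first stage and then surviving a coin flip of fixed bias, which gives (i) and
lets the product bounds (iii+) of the two stages be multiplied.
-/

open scoped ENNReal

noncomputable section

namespace VarOpt

/-! ### Integrals against probability mass functions -/

section PMF

variable {α β : Type*} [MeasurableSpace α] [DiscreteMeasurableSpace α]

theorem ae_toMeasure_iff (p : PMF α) {P : α → Prop} :
    (∀ᵐ a ∂p.toMeasure, P a) ↔ ∀ a ∈ p.support, P a := by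
  rw [ae_iff, PMF.toMeasure_apply_eq_zero_iff _ .of_discrete, Set.disjoint_left]
  simp only [Set.mem_ofPred_eq, not_not]

theorem lintegral_toMeasure_congr (p : PMF α) {f g : α → ℝ≥0∞}
    (h : ∀ a ∈ p.support, f a = g a) : ∫⁻ a, f a ∂p.toMeasure = ∫⁻ a, g a ∂p.toMeasure :=
  lintegral_congr_ae ((ae_toMeasure_iff p).2 h)

theorem lintegral_toMeasure_mono (p : PMF α) {f g : α → ℝ≥0∞}
    (h : ∀ a ∈ p.support, f a ≤ g a) : ∫⁻ a, f a ∂p.toMeasure ≤ ∫⁻ a, g a ∂p.toMeasure :=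
  lintegral_mono_ae ((ae_toMeasure_iff p).2 h)

theorem lintegral_toMeasure (p : PMF α) (f : α → ℝ≥0∞) :
    ∫⁻ a, f a ∂p.toMeasure = ∑' a, p a * f a := by
  have hp : p.toMeasure = Measure.sum fun a => p a • Measure.dirac a := by
    ext s hs
    rw [PMF.toMeasure_apply _ hs, Measure.sum_apply _ hs]
    refine tsum_congr fun a => ?_
    by_cases h : a ∈ s <;> simp [Measure.dirac_apply' _ hs, h]
  simp only [hp, lintegral_sum_measure, lintegral_smul_measure,
    lintegral_dirac' _ (Measurable.of_discrete (f := f)), smul_eq_mul]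

variable [MeasurableSpace β] [DiscreteMeasurableSpace β]

theorem lintegral_toMeasure_bind (p : PMF α) (q : α → PMF β) (f : β → ℝ≥0∞) :
    ∫⁻ b, f b ∂(p.bind q).toMeasure = ∫⁻ a, ∫⁻ b, f b ∂(q a).toMeasure ∂p.toMeasure := by
  simp only [lintegral_toMeasure, PMF.bind_apply, ← ENNReal.tsum_mul_right,
    ← ENNReal.tsum_mul_left]
  rw [ENNReal.tsum_comm]
  simp only [mul_assoc]

end PMF

theorem lintegral_toMeasure_map {α β : Type*} [MeasurableSpace β] [DiscreteMeasurableSpace β]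
    (p : PMF α) (u : α → β) (f : β → ℝ≥0∞) :
    ∫⁻ b, f b ∂(p.map u).toMeasure = ∑' a, p a * f (u a) := by
  let : MeasurableSpace α := ⊤
  have : DiscreteMeasurableSpace α := ⟨fun _ => trivial⟩
  rw [← PMF.toMeasure_map u p .of_discrete, lintegral_map .of_discrete .of_discrete,
    lintegral_toMeasure]

section Indep

variable {α : Type*}

theorem mem_support_indep {m : ℕ} {p : Fin m → PMF α} {f : Fin m → α} :
    f ∈ (indep p).support ↔ ∀ x, f x ∈ (p x).support := by
  change ∏ x, p x (f x) ≠ 0 ↔ _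
  simp only [Finset.prod_ne_zero_iff, Finset.mem_univ, true_imp_iff, PMF.mem_support_iff]

theorem tsum_prod_eq_prod_tsum : ∀ {m : ℕ} {κ : Fin m → Type*} (g : ∀ x, κ x → ℝ≥0∞),
    ∑' f : ∀ x, κ x, ∏ x, g x (f x) = ∏ x, ∑' a, g x a
  | 0, _, g => by simp
  | m + 1, κ, g => by
    rw [← (Fin.consEquiv κ).tsum_eq, ENNReal.tsum_prod']
    simp [Fin.consEquiv, Fin.prod_univ_succ, ENNReal.tsum_mul_left, ENNReal.tsum_mul_right,
      tsum_prod_eq_prod_tsum fun x : Fin m => g x.succ]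

theorem tsum_indep_mul_prod [MeasurableSpace α] [DiscreteMeasurableSpace α] {m : ℕ}
    (p : Fin m → PMF α) (g : Fin m → α → ℝ≥0∞) :
    ∑' f, indep p f * ∏ x, g x (f x) = ∏ x, ∫⁻ a, g x a ∂(p x).toMeasure := by
  simp only [lintegral_toMeasure, ← tsum_prod_eq_prod_tsum, Finset.prod_mul_distrib]
  rfl

end Indep

section Measure

variable {Ω : Type*} [MeasurableSpace Ω] {μ : Measure Ω}

theorem integrable_and_integral_eq_iff {f : Ω → ℝ} {c : ℝ} (hm : AEStronglyMeasurable f μ)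
    (hf : 0 ≤ f) (hc : 0 ≤ c) :
    Integrable f μ ∧ ∫ ω, f ω ∂μ = c ↔ ∫⁻ ω, .ofReal (f ω) ∂μ = .ofReal c := by
  rw [← lintegral_ofReal_ne_top_iff_integrable hm (.of_forall hf),
    integral_eq_lintegral_of_nonneg_ae (.of_forall hf) hm]
  constructor
  · rintro ⟨hfin, rfl⟩
    rw [ENNReal.ofReal_toReal hfin]
  · intro h
    rw [h]
    exact ⟨ENNReal.ofReal_ne_top, ENNReal.toReal_ofReal hc⟩

theorem integrable_and_integral_le_iff {f : Ω → ℝ} {c : ℝ} (hm : AEStronglyMeasurable f μ)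
    (hf : 0 ≤ f) (hc : 0 ≤ c) :
    Integrable f μ ∧ ∫ ω, f ω ∂μ ≤ c ↔ ∫⁻ ω, .ofReal (f ω) ∂μ ≤ .ofReal c := by
  rw [← lintegral_ofReal_ne_top_iff_integrable hm (.of_forall hf),
    integral_eq_lintegral_of_nonneg_ae (.of_forall hf) hm]
  constructor
  · rintro ⟨hfin, h⟩
    exact (ENNReal.le_ofReal_iff_toReal_le hfin hc).2 h
  · intro h
    exact ⟨ne_top_of_le_ne_top ENNReal.ofReal_ne_top h, ENNReal.toReal_le_of_le_ofReal hc h⟩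

theorem covariance_eq_integral_mul_sub [IsProbabilityMeasure μ] {X Y : Ω → ℝ}
    (hX : Integrable X μ) (hY : Integrable Y μ) (hXY : Integrable (fun ω => X ω * Y ω) μ) :
    cov[X, Y; μ] = ∫ ω, X ω * Y ω ∂μ - (∫ ω, X ω ∂μ) * ∫ ω, Y ω ∂μ := by
  set a := ∫ ω, X ω ∂μ with ha
  set b := ∫ ω, Y ω ∂μ with hb
  have hexpand (ω : Ω) : (X ω - a) * (Y ω - b) = X ω * Y ω - (b * X ω + a * (Y ω - b)) := by ring
  have hbX : Integrable (fun ω => b * X ω) μ := hX.const_mul b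
  have hYb : Integrable (fun ω => Y ω - b) μ := hY.sub (integrable_const b)
  have hlin : Integrable (fun ω => b * X ω + a * (Y ω - b)) μ := hbX.add (hYb.const_mul a)
  simp only [covariance, ← ha, ← hb, hexpand]
  rw [integral_sub hXY hlin, integral_add hbX (hYb.const_mul a), integral_const_mul,
    integral_const_mul, integral_sub hY (integrable_const b), integral_const, probReal_univ,
    one_smul, ← ha, ← hb]
  ring

end Measure

/-! ### Sampling schemes -/

section WeightedSet

variable {ι : Type*}

instance WeightedSet.instDiscreteMeasurableSpace : DiscreteMeasurableSpace (WeightedSet ι) :=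
  ⟨fun _ => trivial⟩

theorem WeightedSet.weight_eq_zero_iff (o : WeightedSet ι) (i : ι) :
    o.weight i = 0 ↔ i ∉ o.items :=
  ⟨fun h hi => (o.weight_pos i hi).ne' h, o.weight_eq_zero i⟩

end WeightedSet

namespace Scheme

variable {ι : Type*} {I : WeightedSet ι} {A : Scheme I} {i j : ι} {J : Finset ι}

theorem weight_eq_zero_of_mem_support {o : WeightedSet ι} (ho : o ∈ A.law.support)
    (hi : i ∉ I.items) : o.weight i = 0 :=
  o.weight_eq_zero i fun h => hi (A.subset o ho h)

theorem unbiased_iff : A.Unbiased ↔ ∀ i ∈ I.items,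
    ∫⁻ o, .ofReal (o.weight i) ∂A.law.toMeasure = .ofReal (I.weight i) :=
  forall₂_congr fun i _ => integrable_and_integral_eq_iff
    Measurable.of_discrete.aestronglyMeasurable (fun o => o.weight_nonneg i) (I.weight_nonneg i)

theorem Unbiased.lintegral_weight (hA : A.Unbiased) (i : ι) :
    ∫⁻ o, .ofReal (o.weight i) ∂A.law.toMeasure = .ofReal (I.weight i) := by
  by_cases hi : i ∈ I.items
  · exact unbiased_iff.1 hA i hi
  · rw [lintegral_toMeasure_congr _ fun o ho => congrArg _ (weight_eq_zero_of_mem_support ho hi),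
      I.weight_eq_zero i hi]
    simp only [ENNReal.ofReal_zero, lintegral_zero]

theorem Unbiased.nonposCov_iff [DecidableEq ι] (hA : A.Unbiased) :
    A.NonposCov ↔ ∀ i ∈ I.items, ∀ j ∈ I.items, i ≠ j →
      ∫⁻ o, ∏ l ∈ {i, j}, .ofReal (o.weight l) ∂A.law.toMeasure
        ≤ ∏ l ∈ {i, j}, .ofReal (I.weight l) := by
  refine forall₂_congr fun i hi => forall₂_congr fun j hj => forall_congr' fun hij => ?_
  obtain ⟨hi_int, hi_eq⟩ := hA i hi
  obtain ⟨hj_int, hj_eq⟩ := hA j hj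
  have hcov (h : Integrable (fun o => o.weight i * o.weight j) A.law.toMeasure) :
      cov[fun o => o.weight i, fun o => o.weight j; A.law.toMeasure] ≤ 0 ↔
        ∫ o, o.weight i * o.weight j ∂A.law.toMeasure ≤ I.weight i * I.weight j := by
    rw [covariance_eq_integral_mul_sub hi_int hj_int h, hi_eq, hj_eq, sub_nonpos]
  simp only [Finset.prod_pair hij, ← ENNReal.ofReal_mul (WeightedSet.weight_nonneg _ i)]
  rw [and_iff_right hi_int, and_iff_right hj_int, and_congr_right hcov]
  exact integrable_and_integral_le_iff Measurable.of_discrete.aestronglyMeasurable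
    (fun o => mul_nonneg (o.weight_nonneg i) (o.weight_nonneg j))
    (mul_nonneg (I.weight_nonneg i) (I.weight_nonneg j))

theorem NonposCov.lintegral_prod_weight_le (hA : A.NonposCov) (hu : A.Unbiased)
    (hJ : J.card ≤ 2) :
    ∫⁻ o, ∏ i ∈ J, .ofReal (o.weight i) ∂A.law.toMeasure ≤ ∏ i ∈ J, .ofReal (I.weight i) := by
  classical
  by_cases hJI : J ⊆ I.items
  · obtain h | h | h : J.card = 0 ∨ J.card = 1 ∨ J.card = 2 := by omega
    · obtain rfl := Finset.card_eq_zero.1 h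
      simp
    · obtain ⟨i, rfl⟩ := Finset.card_eq_one.1 h
      simp only [Finset.prod_singleton, hu.lintegral_weight i, le_refl]
    · obtain ⟨i, j, hij, rfl⟩ := Finset.card_eq_two.1 h
      exact hu.nonposCov_iff.1 hA i (hJI (by simp)) j (hJI (by simp)) hij
  · obtain ⟨i, hi, hiI⟩ := Finset.not_subset.1 hJI
    rw [lintegral_toMeasure_congr _ fun o ho => Finset.prod_eq_zero hi (by
      rw [weight_eq_zero_of_mem_support ho hiI, ENNReal.ofReal_zero]), lintegral_zero]
    exact zero_le

/-- The probability that all the items of `J` are sampled, as the expectation of a product of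
indicators, which is the form that independence and linearity apply to. An item is sampled if and
only if its weight estimate is not `0`. -/
def incl (A : Scheme I) (J : Finset ι) : ℝ≥0∞ :=
  ∫⁻ o, ∏ i ∈ J, (if o.weight i = 0 then 0 else 1) ∂A.law.toMeasure

/-- The probability that none of the items of `J` is sampled, as the expectation of a product of
indicators. -/
def excl (A : Scheme I) (J : Finset ι) : ℝ≥0∞ :=
  ∫⁻ o, ∏ i ∈ J, (if o.weight i = 0 then 1 else 0) ∂A.law.toMeasure

theorem incl_eq_toMeasure (A : Scheme I) (J : Finset ι) :
    A.incl J = A.law.toMeasure {o | J ⊆ o.items} := by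
  classical
  rw [incl, ← lintegral_indicator_one .of_discrete]
  refine lintegral_congr fun o => ?_
  simp only [WeightedSet.weight_eq_zero_iff, ite_not, Finset.prod_ite_zero, Finset.prod_const_one]
  rw [Set.indicator_apply]
  exact if_congr .rfl rfl rfl

theorem excl_eq_toMeasure (A : Scheme I) (J : Finset ι) :
    A.excl J = A.law.toMeasure {o | Disjoint J o.items} := by
  classical
  rw [excl, ← lintegral_indicator_one .of_discrete]
  refine lintegral_congr fun o => ?_
  simp only [WeightedSet.weight_eq_zero_iff, Finset.prod_ite_zero, Finset.prod_const_one,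
    ← Finset.disjoint_left]
  rw [Set.indicator_apply]
  exact if_congr .rfl rfl rfl

theorem inclProb_eq_toReal (A : Scheme I) (J : Finset ι) : A.inclProb J = (A.incl J).toReal := by
  rw [incl_eq_toMeasure]
  rfl

theorem exclProb_eq_toReal (A : Scheme I) (J : Finset ι) : A.exclProb J = (A.excl J).toReal := by
  rw [excl_eq_toMeasure]
  rfl

theorem incl_ne_top (A : Scheme I) (J : Finset ι) : A.incl J ≠ ∞ := by
  rw [incl_eq_toMeasure]
  exact measure_ne_top _ _

theorem excl_ne_top (A : Scheme I) (J : Finset ι) : A.excl J ≠ ∞ := by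
  rw [excl_eq_toMeasure]
  exact measure_ne_top _ _

theorem incl_eq_ofReal (A : Scheme I) (J : Finset ι) : A.incl J = .ofReal (A.inclProb J) := by
  rw [inclProb_eq_toReal, ENNReal.ofReal_toReal (A.incl_ne_top J)]

theorem incl_singleton (A : Scheme I) (i : ι) :
    A.incl {i} = ∫⁻ o, (if o.weight i = 0 then 0 else 1) ∂A.law.toMeasure := by
  simp only [incl, Finset.prod_singleton]

theorem excl_singleton (A : Scheme I) (i : ι) :
    A.excl {i} = ∫⁻ o, (if o.weight i = 0 then 1 else 0) ∂A.law.toMeasure := by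
  simp only [excl, Finset.prod_singleton]

theorem incl_add_excl_singleton (A : Scheme I) (i : ι) : A.incl {i} + A.excl {i} = 1 := by
  rw [incl_singleton, excl_singleton, ← lintegral_add_left .of_discrete]
  have hsum (o : WeightedSet ι) :
      ((if o.weight i = 0 then 0 else 1) + if o.weight i = 0 then 1 else 0 : ℝ≥0∞) = 1 := by
    split_ifs <;> simp
  simp only [hsum, lintegral_one, measure_univ]

theorem incl_eq_zero (A : Scheme I) (hi : i ∈ J) (hiI : i ∉ I.items) : A.incl J = 0 := by
  rw [incl, lintegral_toMeasure_congr _ fun o ho =>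
    Finset.prod_eq_zero hi (if_pos (weight_eq_zero_of_mem_support ho hiI)), lintegral_zero]

theorem highOrder_iff : A.HighOrder ↔ ∀ J ⊆ I.items,
    A.incl J ≤ ∏ i ∈ J, A.incl {i} ∧ A.excl J ≤ ∏ i ∈ J, A.excl {i} := by
  refine forall₂_congr fun J _ => ?_
  simp only [inclProb_eq_toReal, exclProb_eq_toReal, ← ENNReal.toReal_prod]
  rw [ENNReal.toReal_le_toReal (A.incl_ne_top J) (ENNReal.prod_ne_top fun i _ => A.incl_ne_top _),
    ENNReal.toReal_le_toReal (A.excl_ne_top J) (ENNReal.prod_ne_top fun i _ => A.excl_ne_top _)]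

theorem HighOrder.incl_le (hA : A.HighOrder) (J : Finset ι) :
    A.incl J ≤ ∏ i ∈ J, A.incl {i} := by
  by_cases hJ : J ⊆ I.items
  · exact (highOrder_iff.1 hA J hJ).1
  · obtain ⟨i, hi, hiI⟩ := Finset.not_subset.1 hJ
    rw [A.incl_eq_zero hi hiI]
    exact zero_le

theorem excl_filter_mem_items [DecidableEq ι] (A : Scheme I) (J : Finset ι) :
    A.excl (J.filter (· ∈ I.items)) = A.excl J := by
  refine lintegral_toMeasure_congr _ fun o ho => Finset.prod_filter_of_ne fun i _ hne => ?_
  contrapose! hne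
  exact if_pos (weight_eq_zero_of_mem_support ho hne)

theorem excl_singleton_eq_one (A : Scheme I) (hi : i ∉ I.items) : A.excl {i} = 1 := by
  rw [← A.incl_add_excl_singleton i, A.incl_eq_zero (Finset.mem_singleton_self i) hi, zero_add]

theorem HighOrder.excl_le (hA : A.HighOrder) (J : Finset ι) :
    A.excl J ≤ ∏ i ∈ J, A.excl {i} := by
  classical
  rw [← A.excl_filter_mem_items, ← Finset.prod_filter_of_ne (p := (· ∈ I.items)) fun i _ hne =>
    by_contra fun hi => hne (A.excl_singleton_eq_one hi)]
  exact (highOrder_iff.1 hA _ fun i hi => (Finset.mem_filter.1 hi).2).2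

theorem HighOrder.lintegral_prod_le (hA : A.HighOrder) (J : Finset ι) (p q : ι → ℝ≥0∞) :
    ∫⁻ o, ∏ i ∈ J, (p i * (if o.weight i = 0 then 1 else 0) + q i) ∂A.law.toMeasure
      ≤ ∏ i ∈ J, (p i * A.excl {i} + q i) := by
  classical
  simp only [Finset.prod_add, Finset.prod_mul_distrib]
  rw [lintegral_finsetSum _ fun _ _ => .of_discrete]
  refine Finset.sum_le_sum fun K _ => ?_
  rw [lintegral_mul_const _ .of_discrete, lintegral_const_mul _ .of_discrete]
  gcongr
  exact hA.excl_le K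

end Scheme

/-! ### Two-stage sampling -/

namespace Scheme

variable {ι : Type*} {I : WeightedSet ι} {A : Scheme I} {B : ∀ v : WeightedSet ι, Scheme v}

/-- Two-stage sampling: run `A`, and then, with fresh randomness, run `B v` on the outcome `v` of
`A`, whose estimates serve as weights. -/
def comp (A : Scheme I) (B : ∀ v : WeightedSet ι, Scheme v) : Scheme I where
  law := A.law.bind fun v => (B v).law
  subset := by
    intro o ho
    obtain ⟨v, hv, hov⟩ := (PMF.mem_support_bind_iff _ _ _).1 ho
    exact ((B v).subset o hov).trans (A.subset v hv)

theorem lintegral_comp (f : WeightedSet ι → ℝ≥0∞) :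
    ∫⁻ o, f o ∂(A.comp B).law.toMeasure =
      ∫⁻ v, ∫⁻ o, f o ∂(B v).law.toMeasure ∂A.law.toMeasure :=
  lintegral_toMeasure_bind _ _ _

theorem Unbiased.comp (hA : A.Unbiased) (hB : ∀ v ∈ A.law.support, (B v).Unbiased) :
    (A.comp B).Unbiased :=
  unbiased_iff.2 fun i _ => by
    rw [lintegral_comp, lintegral_toMeasure_congr _ fun v hv => (hB v hv).lintegral_weight i,
      hA.lintegral_weight]

theorem NonposCov.comp (hA : A.NonposCov) (hAu : A.Unbiased)
    (hB : ∀ v ∈ A.law.support, (B v).NonposCov) (hBu : ∀ v ∈ A.law.support, (B v).Unbiased) :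
    (A.comp B).NonposCov := by
  classical
  refine (hAu.comp hBu).nonposCov_iff.2 fun i hi j hj hij => ?_
  calc ∫⁻ o, ∏ l ∈ {i, j}, .ofReal (o.weight l) ∂(A.comp B).law.toMeasure
      = ∫⁻ v, ∫⁻ o, ∏ l ∈ {i, j}, .ofReal (o.weight l) ∂(B v).law.toMeasure ∂A.law.toMeasure :=
        lintegral_comp _
    _ ≤ ∫⁻ v, ∏ l ∈ {i, j}, .ofReal (v.weight l) ∂A.law.toMeasure :=
        lintegral_toMeasure_mono _ fun v hv =>
          (hB v hv).lintegral_prod_weight_le (hBu v hv) Finset.card_le_two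
    _ ≤ ∏ l ∈ {i, j}, .ofReal (I.weight l) := hAu.nonposCov_iff.1 hA i hi j hj hij

theorem AtMost.comp {k : ℕ} (hB : ∀ v ∈ A.law.support, (B v).AtMost k) :
    (A.comp B).AtMost k := by
  intro o ho
  obtain ⟨v, hv, hov⟩ := (PMF.mem_support_bind_iff _ _ _).1 ho
  exact hB v hv o hov

theorem incl_singleton_eq_mul {i : ι} {p : ℝ≥0∞} (hp : i ∈ I.items → A.incl {i} = p) :
    A.incl {i} = p * if I.weight i = 0 then 0 else 1 := by
  by_cases hi : i ∈ I.items
  · rw [hp hi, if_neg (I.weight_pos i hi).ne', mul_one]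
  · rw [A.incl_eq_zero (Finset.mem_singleton_self i) hi, if_pos (I.weight_eq_zero i hi), mul_zero]

theorem excl_singleton_eq_mul_add {i : ι} {p : ℝ≥0∞} (hp_le : p ≤ 1)
    (hp : i ∈ I.items → A.incl {i} = p) :
    A.excl {i} = p * (if I.weight i = 0 then 1 else 0) + (1 - p) := by
  by_cases hi : i ∈ I.items
  · rw [if_neg (I.weight_pos i hi).ne', mul_zero, zero_add, ← hp hi,
      ← A.incl_add_excl_singleton i, ENNReal.add_sub_cancel_left (A.incl_ne_top _)]
  · rw [A.excl_singleton_eq_one hi, if_pos (I.weight_eq_zero i hi), mul_one,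
      add_tsub_cancel_of_le hp_le]

variable {p : ι → ℝ≥0∞}

theorem incl_singleton_comp {i : ι}
    (hp : ∀ v ∈ A.law.support, i ∈ v.items → (B v).incl {i} = p i) :
    (A.comp B).incl {i} = p i * A.incl {i} := by
  calc (A.comp B).incl {i} = ∫⁻ v, (B v).incl {i} ∂A.law.toMeasure := lintegral_comp _
    _ = ∫⁻ v, p i * (if v.weight i = 0 then 0 else 1) ∂A.law.toMeasure :=
        lintegral_toMeasure_congr _ fun v hv => incl_singleton_eq_mul (hp v hv)
    _ = p i * A.incl {i} := by rw [lintegral_const_mul _ .of_discrete, incl_singleton]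

theorem excl_singleton_comp {i : ι} (hp_le : p i ≤ 1)
    (hp : ∀ v ∈ A.law.support, i ∈ v.items → (B v).incl {i} = p i) :
    (A.comp B).excl {i} = p i * A.excl {i} + (1 - p i) := by
  calc (A.comp B).excl {i} = ∫⁻ v, (B v).excl {i} ∂A.law.toMeasure := lintegral_comp _
    _ = ∫⁻ v, (p i * (if v.weight i = 0 then 1 else 0) + (1 - p i)) ∂A.law.toMeasure :=
        lintegral_toMeasure_congr _ fun v hv => excl_singleton_eq_mul_add hp_le (hp v hv)
    _ = p i * A.excl {i} + (1 - p i) := by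
        rw [lintegral_add_left .of_discrete, lintegral_const_mul _ .of_discrete, excl_singleton,
          lintegral_const, measure_univ, mul_one]

theorem HighOrder.comp (hA : A.HighOrder) (hB : ∀ v ∈ A.law.support, (B v).HighOrder)
    (hp_le : ∀ i ∈ I.items, p i ≤ 1)
    (hp : ∀ v ∈ A.law.support, ∀ i ∈ v.items, (B v).incl {i} = p i) :
    (A.comp B).HighOrder := by
  refine highOrder_iff.2 fun J hJ => ⟨?_, ?_⟩
  · calc (A.comp B).incl J = ∫⁻ v, (B v).incl J ∂A.law.toMeasure := lintegral_comp _
      _ ≤ ∫⁻ v, ∏ i ∈ J, p i * (if v.weight i = 0 then 0 else 1) ∂A.law.toMeasure :=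
          lintegral_toMeasure_mono _ fun v hv => ((hB v hv).incl_le J).trans_eq <|
            Finset.prod_congr rfl fun i _ => incl_singleton_eq_mul (hp v hv i)
      _ = (∏ i ∈ J, p i) * A.incl J := by
          simp only [Finset.prod_mul_distrib]
          exact lintegral_const_mul _ .of_discrete
      _ ≤ (∏ i ∈ J, p i) * ∏ i ∈ J, A.incl {i} := by
          gcongr
          exact hA.incl_le J
      _ = ∏ i ∈ J, (A.comp B).incl {i} := by
          rw [← Finset.prod_mul_distrib]
          exact Finset.prod_congr rfl fun i _ =>
            (incl_singleton_comp fun v hv => hp v hv i).symm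
  · calc (A.comp B).excl J = ∫⁻ v, (B v).excl J ∂A.law.toMeasure := lintegral_comp _
      _ ≤ ∫⁻ v, ∏ i ∈ J, (p i * (if v.weight i = 0 then 1 else 0) + (1 - p i)) ∂A.law.toMeasure :=
          lintegral_toMeasure_mono _ fun v hv => ((hB v hv).excl_le J).trans_eq <|
            Finset.prod_congr rfl fun i hi =>
              excl_singleton_eq_mul_add (hp_le i (hJ hi)) (hp v hv i)
      _ ≤ ∏ i ∈ J, (p i * A.excl {i} + (1 - p i)) := hA.lintegral_prod_le J p fun i => 1 - p i
      _ = ∏ i ∈ J, (A.comp B).excl {i} := Finset.prod_congr rfl fun i hi =>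
            (excl_singleton_comp (hp_le i (hJ hi)) fun v hv => hp v hv i).symm

end Scheme

/-! ### Independent unions of schemes -/

theorem prod_eq_prod_prod_inter {ι κ M : Type*} [DecidableEq ι] [Fintype κ] [CommMonoid M]
    {s : κ → Finset ι} (hs : Pairwise fun x y => Disjoint (s x) (s y)) {J : Finset ι}
    (hJ : J ⊆ Finset.univ.biUnion s) (g : ι → M) :
    ∏ i ∈ J, g i = ∏ x, ∏ i ∈ J ∩ s x, g i := by
  rw [← Finset.prod_biUnion fun x _ y _ hxy =>
      (hs hxy).mono Finset.inter_subset_right Finset.inter_subset_right,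
    ← Finset.inter_biUnion, Finset.inter_eq_left.2 hJ]

section Union

variable {ι : Type*} [DecidableEq ι] {m : ℕ} {I : Fin m → WeightedSet ι}
  {inner : ∀ x, Scheme (I x)}

theorem WeightedSet.mem_union {v : Fin m → WeightedSet ι} {i : ι} :
    i ∈ (WeightedSet.union v).items ↔ ∃ x, i ∈ (v x).items := by
  simp only [WeightedSet.union, Finset.mem_biUnion, Finset.mem_univ, true_and]

theorem WeightedSet.union_weight (hI : Pairwise fun x y => Disjoint (I x).items (I y).items)
    {v : Fin m → WeightedSet ι} (hv : ∀ x, (v x).items ⊆ (I x).items) {x : Fin m} {i : ι}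
    (hi : i ∈ (I x).items) : (WeightedSet.union v).weight i = (v x).weight i :=
  Fintype.sum_eq_single x fun y hyx => (v y).weight_eq_zero i fun h =>
    Finset.disjoint_left.1 (hI hyx) (hv y h) hi

theorem mem_support_innerUnion {v : WeightedSet ι} (hv : v ∈ (innerUnion inner).law.support) :
    ∃ f : Fin m → WeightedSet ι, (∀ x, f x ∈ (inner x).law.support) ∧ WeightedSet.union f = v := by
  obtain ⟨f, hf, h⟩ := (PMF.mem_support_map_iff _ _ _).1 hv
  exact ⟨f, mem_support_indep.1 hf, h⟩

theorem lintegral_innerUnion_prod (hI : Pairwise fun x y => Disjoint (I x).items (I y).items)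
    {J : Finset ι} (hJ : J ⊆ (WeightedSet.union I).items) (g : ι → ℝ → ℝ≥0∞) :
    ∫⁻ o, ∏ i ∈ J, g i (o.weight i) ∂(innerUnion inner).law.toMeasure =
      ∏ x, ∫⁻ o, ∏ i ∈ J ∩ (I x).items, g i (o.weight i) ∂(inner x).law.toMeasure := by
  calc ∫⁻ o, ∏ i ∈ J, g i (o.weight i) ∂(innerUnion inner).law.toMeasure
      = ∑' f, indep (fun x => (inner x).law) f *
          ∏ i ∈ J, g i ((WeightedSet.union f).weight i) := lintegral_toMeasure_map _ _ _
    _ = ∑' f, indep (fun x => (inner x).law) f *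
          ∏ x, ∏ i ∈ J ∩ (I x).items, g i ((f x).weight i) := by
        refine tsum_congr fun f => ?_
        by_cases hf : f ∈ (indep fun x => (inner x).law).support
        · have hsub (x : Fin m) := (inner x).subset _ (mem_support_indep.1 hf x)
          rw [prod_eq_prod_prod_inter hI hJ]
          congr! 3 with x _ i hi
          rw [WeightedSet.union_weight hI hsub (Finset.mem_inter.1 hi).2]
        · rw [(PMF.apply_eq_zero_iff _ _).2 hf, zero_mul, zero_mul]
    _ = _ := tsum_indep_mul_prod (fun x => (inner x).law) fun x o =>
          ∏ i ∈ J ∩ (I x).items, g i (o.weight i)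

theorem lintegral_innerUnion_weight (hI : Pairwise fun x y => Disjoint (I x).items (I y).items)
    {x : Fin m} {i : ι} (hi : i ∈ (I x).items) (g : ℝ → ℝ≥0∞) :
    ∫⁻ o, g (o.weight i) ∂(innerUnion inner).law.toMeasure =
      ∫⁻ o, g (o.weight i) ∂(inner x).law.toMeasure := by
  have hprod := lintegral_innerUnion_prod (inner := inner) hI
    (Finset.singleton_subset_iff.2 (WeightedSet.mem_union.2 ⟨x, hi⟩)) fun _ => g
  rw [Fintype.prod_eq_single x, Finset.singleton_inter_of_mem hi] at hprod
  · simpa only [Finset.prod_singleton] using hprod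
  · intro y hyx
    rw [Finset.singleton_inter_of_notMem fun h => Finset.disjoint_left.1 (hI hyx) h hi]
    simp only [Finset.prod_empty, lintegral_one, measure_univ]

namespace Scheme

theorem incl_singleton_innerUnion (hI : Pairwise fun x y => Disjoint (I x).items (I y).items)
    {x : Fin m} {i : ι} (hi : i ∈ (I x).items) :
    (VarOpt.innerUnion inner).incl {i} = (inner x).incl {i} := by
  rw [incl_singleton, incl_singleton]
  exact lintegral_innerUnion_weight hI hi fun w => if w = 0 then 0 else 1

theorem excl_singleton_innerUnion (hI : Pairwise fun x y => Disjoint (I x).items (I y).items)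
    {x : Fin m} {i : ι} (hi : i ∈ (I x).items) :
    (VarOpt.innerUnion inner).excl {i} = (inner x).excl {i} := by
  rw [excl_singleton, excl_singleton]
  exact lintegral_innerUnion_weight hI hi fun w => if w = 0 then 1 else 0

theorem Unbiased.innerUnion (hI : Pairwise fun x y => Disjoint (I x).items (I y).items)
    (h : ∀ x, (inner x).Unbiased) : (VarOpt.innerUnion inner).Unbiased := by
  refine unbiased_iff.2 fun i hi => ?_
  obtain ⟨x, hx⟩ := WeightedSet.mem_union.1 hi
  rw [lintegral_innerUnion_weight hI hx, (h x).lintegral_weight,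
    WeightedSet.union_weight hI (fun _ => subset_rfl) hx]

theorem NonposCov.innerUnion (hI : Pairwise fun x y => Disjoint (I x).items (I y).items)
    (hu : ∀ x, (inner x).Unbiased) (h : ∀ x, (inner x).NonposCov) :
    (VarOpt.innerUnion inner).NonposCov := by
  refine (Unbiased.innerUnion hI hu).nonposCov_iff.2 fun i hi j hj _ => ?_
  have hJ : {i, j} ⊆ (WeightedSet.union I).items :=
    Finset.insert_subset hi (Finset.singleton_subset_iff.2 hj)
  rw [lintegral_innerUnion_prod hI hJ fun _ w => .ofReal w, prod_eq_prod_prod_inter hI hJ]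
  refine Finset.prod_le_prod' fun x _ => ?_
  calc ∫⁻ o, ∏ l ∈ {i, j} ∩ (I x).items, .ofReal (o.weight l) ∂(inner x).law.toMeasure
      ≤ ∏ l ∈ {i, j} ∩ (I x).items, .ofReal ((I x).weight l) :=
        (h x).lintegral_prod_weight_le (hu x) <|
          (Finset.card_le_card Finset.inter_subset_left).trans Finset.card_le_two
    _ = ∏ l ∈ {i, j} ∩ (I x).items, .ofReal ((WeightedSet.union I).weight l) :=
        Finset.prod_congr rfl fun l hl => by
          rw [WeightedSet.union_weight hI (fun _ => subset_rfl) (Finset.mem_inter.1 hl).2]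

theorem HighOrder.innerUnion (hI : Pairwise fun x y => Disjoint (I x).items (I y).items)
    (h : ∀ x, (inner x).HighOrder) : (VarOpt.innerUnion inner).HighOrder := by
  refine highOrder_iff.2 fun J hJ => ⟨?_, ?_⟩
  · rw [incl, lintegral_innerUnion_prod hI hJ fun _ w => if w = 0 then 0 else 1,
      prod_eq_prod_prod_inter hI hJ]
    refine Finset.prod_le_prod' fun x _ => ((h x).incl_le _).trans_eq ?_
    exact Finset.prod_congr rfl fun i hi =>
      (incl_singleton_innerUnion hI (Finset.mem_inter.1 hi).2).symm
  · rw [excl, lintegral_innerUnion_prod hI hJ fun _ w => if w = 0 then 1 else 0,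
      prod_eq_prod_prod_inter hI hJ]
    refine Finset.prod_le_prod' fun x _ => ((h x).excl_le _).trans_eq ?_
    exact Finset.prod_congr rfl fun i hi =>
      (excl_singleton_innerUnion hI (Finset.mem_inter.1 hi).2).symm

end Scheme

end Union

/-! ### Horvitz-Thompson estimation -/

namespace Scheme

variable {ι : Type*} {I : WeightedSet ι} {A : Scheme I} {c d : ι → ℝ}

theorem mem_of_incl_singleton_eq_one {i : ι} (h : A.incl {i} = 1) {o : WeightedSet ι}
    (ho : o ∈ A.law.support) : i ∈ o.items := by
  rw [incl_eq_toMeasure, PMF.toMeasure_apply_eq_one_iff _ .of_discrete] at h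
  exact Finset.singleton_subset_iff.1 (h ho)

theorem lintegral_card_items (A : Scheme I) :
    ∫⁻ o, (o.items.card : ℝ≥0∞) ∂A.law.toMeasure = ∑ i ∈ I.items, A.incl {i} := by
  classical
  simp only [incl_singleton]
  rw [← lintegral_finsetSum _ fun _ _ => .of_discrete]
  refine lintegral_toMeasure_congr _ fun o ho => ?_
  simp only [WeightedSet.weight_eq_zero_iff, ite_not, Finset.sum_boole]
  rw [Finset.filter_mem_eq_inter, Finset.inter_eq_right.2 (A.subset o ho)]

theorem AtMost.card_eq {n : ℕ} (hA : A.AtMost n) (hn : ∑ i ∈ I.items, A.incl {i} = n)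
    {o : WeightedSet ι} (ho : o ∈ A.law.support) : o.items.card = n := by
  have hle : ∀ᵐ o ∂A.law.toMeasure, (o.items.card : ℝ≥0∞) ≤ n :=
    (ae_toMeasure_iff _).2 fun o ho => Nat.cast_le.2 (hA o ho)
  have hmean : ∫⁻ o, (o.items.card : ℝ≥0∞) ∂A.law.toMeasure = n := A.lintegral_card_items.trans hn
  have heq := ae_eq_of_ae_le_of_lintegral_le hle (by rw [hmean]; exact ENNReal.natCast_ne_top n)
    aemeasurable_const (by rw [hmean, lintegral_const, measure_univ, mul_one])
  exact Nat.cast_inj.1 ((ae_toMeasure_iff _).1 heq o ho)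

/-- The scheme samples every item `i` with probability `I.weight i / c i` and uses the
Horvitz-Thompson estimates, so that a sampled item `i` always gets the estimate `c i`. -/
structure HorvitzThompson (c : ι → ℝ) (A : Scheme I) : Prop where
  incl_eq : ∀ i ∈ I.items, A.incl {i} = .ofReal (I.weight i / c i)
  weight_eq : ∀ o ∈ A.law.support, ∀ i ∈ o.items, o.weight i = c i

namespace HorvitzThompson

theorem congr (hA : A.HorvitzThompson c) (h : ∀ i ∈ I.items, c i = d i) :
    A.HorvitzThompson d where
  incl_eq i hi := by rw [hA.incl_eq i hi, h i hi]
  weight_eq o ho i hi := by rw [hA.weight_eq o ho i hi, h i (A.subset o ho hi)]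

theorem incl_second_stage (hA : A.HorvitzThompson c) {v : WeightedSet ι}
    (hv : v ∈ A.law.support) {C : Scheme v} (hC : C.HorvitzThompson d) {i : ι}
    (hi : i ∈ v.items) : C.incl {i} = .ofReal (c i / d i) := by
  rw [hC.incl_eq i hi, hA.weight_eq v hv i hi]

theorem comp {B : ∀ v : WeightedSet ι, Scheme v} (hA : A.HorvitzThompson c)
    (hc : ∀ i ∈ I.items, 0 < c i) (hB : ∀ v ∈ A.law.support, (B v).HorvitzThompson d) :
    (A.comp B).HorvitzThompson d where
  incl_eq i hi := by
    rw [incl_singleton_comp (p := fun i => .ofReal (c i / d i)) fun v hv hiv =>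
        hA.incl_second_stage hv (hB v hv) hiv,
      hA.incl_eq i hi, ← ENNReal.ofReal_mul' (div_nonneg (I.weight_nonneg i) (hc i hi).le),
      div_mul_div_comm, mul_comm (d i), mul_div_mul_left _ _ (hc i hi).ne']
  weight_eq o ho i hi := by
    obtain ⟨v, hv, hov⟩ := (PMF.mem_support_bind_iff _ _ _).1 ho
    exact (hB v hv).weight_eq o hov i hi

theorem innerUnion [DecidableEq ι] {m : ℕ} {I : Fin m → WeightedSet ι}
    {inner : ∀ x, Scheme (I x)} (hI : Pairwise fun x y => Disjoint (I x).items (I y).items)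
    (h : ∀ x, (inner x).HorvitzThompson c) : (VarOpt.innerUnion inner).HorvitzThompson c where
  incl_eq i hi := by
    obtain ⟨x, hx⟩ := WeightedSet.mem_union.1 hi
    rw [incl_singleton_innerUnion hI hx, (h x).incl_eq i hx,
      WeightedSet.union_weight hI (fun _ => subset_rfl) hx]
  weight_eq v hv i hi := by
    obtain ⟨f, hf, rfl⟩ := mem_support_innerUnion hv
    obtain ⟨x, hx⟩ := WeightedSet.mem_union.1 hi
    have hsub (y : Fin m) := (inner y).subset _ (hf y)
    rw [WeightedSet.union_weight hI hsub (hsub x hx), (h x).weight_eq _ (hf x) i hx]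

end HorvitzThompson

end Scheme

/-! ### Thresholds -/

section Threshold

variable {ι : Type*} {I : WeightedSet ι} {k : ℕ} {σ τ : ℝ}

theorem min_one_div_eq_div_max {w : ℝ} (hw : 0 < w) (hτ : 0 < τ) :
    min 1 (w / τ) = w / max w τ := by
  rcases le_total w τ with h | h
  · rw [max_eq_right h, min_eq_right ((div_le_one hτ).2 h)]
  · rw [max_eq_left h, div_self hw.ne', min_eq_left ((one_le_div hτ).2 h)]

theorem thresholdProb_eq_div_max {w : ℝ} (hw : 0 < w) (hτ : 0 ≤ τ) :
    thresholdProb w τ = w / max w τ := by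
  unfold thresholdProb
  split_ifs with h
  · rw [h, max_eq_left hw.le, div_self hw.ne']
  · exact min_one_div_eq_div_max hw (hτ.lt_of_ne' h)

theorem div_max_sub_mul_div_max {w : ℝ} (hw : 0 < w) (hστ : σ ≤ τ) :
    w / max w τ - σ / τ * (w / max w σ) = max w σ / max w τ - σ / τ := by
  rcases le_or_gt σ w with h | h
  · rw [max_eq_left h, div_self hw.ne', mul_one]
  · rw [max_eq_right h.le, max_eq_right (h.le.trans hστ), div_mul_div_cancel₀' (hw.trans h).ne',
      sub_self, sub_self]

namespace WeightedSet

/-- The expected sample size of threshold sampling with the threshold `τ`. For `w > 0` and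
`τ ≥ 0` the threshold probability of `w` is `w / max w τ`, also at `τ = 0`. -/
def thresholdSum (I : WeightedSet ι) (τ : ℝ) : ℝ := ∑ i ∈ I.items, I.weight i / max (I.weight i) τ

theorem thresholdSum_eq_sum_min (I : WeightedSet ι) (hτ : 0 < τ) :
    I.thresholdSum τ = ∑ i ∈ I.items, min 1 (I.weight i / τ) :=
  Finset.sum_congr rfl fun i hi => (min_one_div_eq_div_max (I.weight_pos i hi) hτ).symm

theorem thresholdSum_eq_card (h : ∀ i ∈ I.items, τ ≤ I.weight i) :
    I.thresholdSum τ = I.items.card := by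
  rw [thresholdSum, Finset.sum_congr rfl fun i hi => by
    rw [max_eq_left (h i hi), div_self (I.weight_pos i hi).ne'], Finset.sum_const, nsmul_one]

theorem thresholdSum_zero (I : WeightedSet ι) : I.thresholdSum 0 = I.items.card :=
  thresholdSum_eq_card fun i _ => I.weight_nonneg i

theorem div_max_weight_nonneg (I : WeightedSet ι) (i : ι) (τ : ℝ) :
    0 ≤ I.weight i / max (I.weight i) τ :=
  div_nonneg (I.weight_nonneg i) (le_max_of_le_left (I.weight_nonneg i))

theorem thresholdSum_nonneg (I : WeightedSet ι) (τ : ℝ) : 0 ≤ I.thresholdSum τ :=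
  Finset.sum_nonneg fun i _ => I.div_max_weight_nonneg i τ

theorem thresholdSum_le_card (I : WeightedSet ι) (τ : ℝ) : I.thresholdSum τ ≤ I.items.card := by
  rw [← nsmul_one]
  exact Finset.sum_le_card_nsmul _ _ _ fun i _ =>
    div_le_one_of_le₀ (le_max_left _ _) (le_max_of_le_left (I.weight_nonneg i))

theorem div_max_weight_antitone (hστ : σ ≤ τ) {i : ι} (hi : i ∈ I.items) :
    I.weight i / max (I.weight i) τ ≤ I.weight i / max (I.weight i) σ :=
  div_le_div_of_nonneg_left (I.weight_nonneg i) (lt_max_of_lt_left (I.weight_pos i hi))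
    (max_le_max_left _ hστ)

theorem thresholdSum_antitone (I : WeightedSet ι) : Antitone I.thresholdSum :=
  fun _ _ hστ => Finset.sum_le_sum fun _ hi => div_max_weight_antitone hστ hi

theorem max_weight_eq_of_thresholdSum_eq (h : I.thresholdSum σ = I.thresholdSum τ) {i : ι}
    (hi : i ∈ I.items) : max (I.weight i) σ = max (I.weight i) τ := by
  wlog hστ : σ ≤ τ generalizing σ τ
  · exact (this h.symm (le_of_not_ge hστ)).symm
  have hterms := (Finset.sum_eq_sum_iff_of_le fun _ hj => div_max_weight_antitone hστ hj).1 h.symm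
  have hterm := hterms i hi
  rw [div_eq_mul_inv, div_eq_mul_inv] at hterm
  exact (inv_injective (mul_left_cancel₀ (I.weight_pos i hi).ne' hterm)).symm

theorem continuous_thresholdSum (I : WeightedSet ι) : Continuous I.thresholdSum :=
  continuous_finsetSum _ fun i hi => continuous_const.div (continuous_const.max continuous_id)
    fun _ => (lt_max_of_lt_left (I.weight_pos i hi)).ne'

end WeightedSet

theorem IsThreshold.nonneg (h : IsThreshold k I τ) : 0 ≤ τ := by
  obtain ⟨-, hτ, -⟩ | ⟨-, hτ⟩ := h
  exacts [hτ.le, hτ.ge]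

theorem IsThreshold.thresholdSum_eq (h : IsThreshold k I τ) :
    I.thresholdSum τ = (min k I.items.card : ℕ) := by
  obtain ⟨hcard, hτ, hsum⟩ | ⟨hcard, rfl⟩ := h
  · rw [I.thresholdSum_eq_sum_min hτ, hsum, min_eq_left hcard.le]
  · rw [I.thresholdSum_zero, min_eq_right hcard]

theorem IsThreshold.le_of_thresholdSum_le (hσ : IsThreshold k I σ) (hτ : 0 ≤ τ)
    (h : I.thresholdSum τ ≤ k) : σ ≤ τ := by
  by_contra! hτσ
  obtain ⟨hcard, -⟩ | ⟨-, rfl⟩ := id hσ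
  · have hsum : I.thresholdSum σ = k := by rw [hσ.thresholdSum_eq, min_eq_left hcard.le]
    have heq : I.thresholdSum σ = I.thresholdSum τ :=
      (I.thresholdSum_antitone hτσ.le).antisymm (h.trans hsum.ge)
    have hweight : ∀ i ∈ I.items, σ ≤ I.weight i := fun i hi => by
      have hmax := WeightedSet.max_weight_eq_of_thresholdSum_eq heq hi
      have hle : σ ≤ max (I.weight i) τ := hmax ▸ le_max_right _ _
      exact (le_max_iff.1 hle).resolve_right hτσ.not_ge
    rw [WeightedSet.thresholdSum_eq_card hweight, Nat.cast_inj] at hsum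
    exact hcard.ne' hsum
  · exact hτσ.not_ge hτ

theorem exists_isThreshold (hk : 1 ≤ k) (I : WeightedSet ι) : ∃ τ, IsThreshold k I τ := by
  rcases le_or_gt I.items.card k with hcard | hcard
  · exact ⟨0, .inr ⟨hcard, rfl⟩⟩
  have hk_pos : (0 : ℝ) < k := Nat.cast_pos.2 hk
  have hsum_pos : 0 < ∑ i ∈ I.items, I.weight i :=
    Finset.sum_pos I.weight_pos (Finset.card_pos.1 (Nat.zero_lt_of_lt hcard))
  set b := (∑ i ∈ I.items, I.weight i) / k with hb
  have hb_pos : 0 < b := div_pos hsum_pos hk_pos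
  have hb_le : I.thresholdSum b ≤ k := by
    calc I.thresholdSum b ≤ ∑ i ∈ I.items, I.weight i / b :=
          Finset.sum_le_sum fun i _ =>
            div_le_div_of_nonneg_left (I.weight_nonneg i) hb_pos (le_max_right _ _)
      _ = k := by rw [← Finset.sum_div, hb, div_div_cancel₀ hsum_pos.ne']
  have hzero_ge : (k : ℝ) ≤ I.thresholdSum 0 := by
    rw [I.thresholdSum_zero]
    exact Nat.cast_le.2 hcard.le
  obtain ⟨τ, hτ, hsum⟩ := intermediate_value_Icc' hb_pos.le I.continuous_thresholdSum.continuousOn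
    ⟨hb_le, hzero_ge⟩
  have hτ_ne : τ ≠ 0 := by
    rintro rfl
    rw [I.thresholdSum_zero, Nat.cast_inj] at hsum
    exact hcard.ne' hsum
  have hτ_pos : 0 < τ := hτ.1.lt_of_ne' hτ_ne
  exact ⟨τ, .inl ⟨hcard, hτ_pos, I.thresholdSum_eq_sum_min hτ_pos ▸ hsum⟩⟩

end Threshold

/-! ### Threshold sampling -/

section ThresholdSampling

namespace Scheme

variable {ι : Type*} {I v : WeightedSet ι} {A : Scheme I} {k : ℕ} {σ τ : ℝ}

theorem inclProb_eq_iff (A : Scheme I) (J : Finset ι) {r : ℝ} (hr : 0 ≤ r) :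
    A.inclProb J = r ↔ A.incl J = .ofReal r := by
  have hnonneg : 0 ≤ A.inclProb J := measureReal_nonneg
  rw [incl_eq_ofReal, ENNReal.ofReal_eq_ofReal_iff hnonneg hr]

theorem ipps_iff : A.Ipps k ↔
    ∃ τ, IsThreshold k I τ ∧ A.HorvitzThompson fun i => max (I.weight i) τ := by
  refine exists_congr fun τ => and_congr_right fun hτ => ?_
  have hincl : (∀ i ∈ I.items, A.inclProb {i} = thresholdProb (I.weight i) τ) ↔
      ∀ i ∈ I.items, A.incl {i} = .ofReal (I.weight i / max (I.weight i) τ) :=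
    forall₂_congr fun i hi => by
      rw [thresholdProb_eq_div_max (I.weight_pos i hi) hτ.nonneg,
        A.inclProb_eq_iff _ (I.div_max_weight_nonneg i τ)]
  rw [hincl]
  exact ⟨fun h => ⟨h.1, h.2⟩, fun h => ⟨h.incl_eq, h.weight_eq⟩⟩

theorem Ipps.horvitzThompson (hA : A.Ipps k) (h : I.thresholdSum τ = (min k I.items.card : ℕ)) :
    A.HorvitzThompson fun i => max (I.weight i) τ := by
  obtain ⟨σ, hσ, hAσ⟩ := ipps_iff.1 hA
  exact hAσ.congr fun i hi =>
    WeightedSet.max_weight_eq_of_thresholdSum_eq (hσ.thresholdSum_eq.trans h.symm) hi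

theorem Ipps.horvitzThompson_of_thresholdSum_eq {B : Scheme v} (hB : B.Ipps k)
    (hτ : IsThreshold k I τ) (hv : v.items ⊆ I.items) (h : v.thresholdSum τ = I.thresholdSum τ) :
    B.HorvitzThompson fun i => max (v.weight i) τ := by
  refine hB.horvitzThompson ?_
  rw [h, hτ.thresholdSum_eq, Nat.cast_inj]
  refine le_antisymm (le_min (min_le_left _ _) ?_) (min_le_min_left _ (Finset.card_le_card hv))
  rw [← Nat.cast_le (α := ℝ), ← hτ.thresholdSum_eq, ← h]
  exact v.thresholdSum_le_card τ

namespace HorvitzThompson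

theorem sum_incl (hA : A.HorvitzThompson fun i => max (I.weight i) σ) :
    ∑ i ∈ I.items, A.incl {i} = .ofReal (I.thresholdSum σ) := by
  rw [WeightedSet.thresholdSum,
    ENNReal.ofReal_sum_of_nonneg fun i _ => I.div_max_weight_nonneg i σ]
  exact Finset.sum_congr rfl hA.incl_eq

theorem card_eq (hA : A.HorvitzThompson fun i => max (I.weight i) σ) (hσ : IsThreshold k I σ)
    (hk : A.AtMost k) {o : WeightedSet ι} (ho : o ∈ A.law.support) :
    (o.items.card : ℝ) = I.thresholdSum σ := by
  have hmin : A.AtMost (min k I.items.card) := fun o ho =>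
    le_min (hk o ho) (Finset.card_le_card (A.subset o ho))
  rw [hσ.thresholdSum_eq, hmin.card_eq _ ho]
  rw [hA.sum_incl, hσ.thresholdSum_eq, ENNReal.ofReal_natCast]

theorem mem_items_of_le (hA : A.HorvitzThompson fun i => max (I.weight i) σ) {i : ι}
    (hi : i ∈ I.items) (hσi : σ ≤ I.weight i) {o : WeightedSet ι} (ho : o ∈ A.law.support) :
    i ∈ o.items := by
  refine mem_of_incl_singleton_eq_one ?_ ho
  rw [hA.incl_eq i hi, max_eq_left hσi, div_self (I.weight_pos i hi).ne', ENNReal.ofReal_one]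

theorem thresholdSum_eq (hA : A.HorvitzThompson fun i => max (I.weight i) σ) (hστ : σ ≤ τ)
    {o : WeightedSet ι} (ho : o ∈ A.law.support) (hcard : o.items.card = I.thresholdSum σ) :
    o.thresholdSum τ = I.thresholdSum τ := by
  have hestimate : o.thresholdSum τ =
      ∑ i ∈ o.items, max (I.weight i) σ / max (I.weight i) τ :=
    Finset.sum_congr rfl fun i hi => by
      rw [hA.weight_eq o ho i hi, max_assoc, max_eq_right hστ]
  have hunsampled : ∀ i ∈ I.items, i ∉ o.items →
      max (I.weight i) σ / max (I.weight i) τ - σ / τ = 0 := fun i hi hio => by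
    have hlt : I.weight i < σ := not_le.1 fun hle => hio (hA.mem_items_of_le hi hle ho)
    rw [max_eq_right hlt.le, max_eq_right (hlt.le.trans hστ), sub_self]
  have hsum : o.thresholdSum τ - σ / τ * o.items.card =
      I.thresholdSum τ - σ / τ * I.thresholdSum σ := by
    calc o.thresholdSum τ - σ / τ * o.items.card
        = ∑ i ∈ o.items, (max (I.weight i) σ / max (I.weight i) τ - σ / τ) := by
          rw [hestimate, Finset.sum_sub_distrib, Finset.sum_const, nsmul_eq_mul, mul_comm]
      _ = ∑ i ∈ I.items, (max (I.weight i) σ / max (I.weight i) τ - σ / τ) :=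
          Finset.sum_subset (A.subset o ho) hunsampled
      _ = ∑ i ∈ I.items,
            (I.weight i / max (I.weight i) τ - σ / τ * (I.weight i / max (I.weight i) σ)) :=
          Finset.sum_congr rfl fun i hi => (div_max_sub_mul_div_max (I.weight_pos i hi) hστ).symm
      _ = I.thresholdSum τ - σ / τ * I.thresholdSum σ := by
          rw [Finset.sum_sub_distrib, ← Finset.mul_sum, WeightedSet.thresholdSum,
            WeightedSet.thresholdSum]
  rwa [hcard, sub_left_inj] at hsum

end HorvitzThompson

end Scheme

end ThresholdSampling

/-! ### The recurrence -/

theorem exists_eq_on_parts {ι κ α : Type*} [Nonempty α] {s : κ → Finset ι}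
    (hs : Pairwise fun x y => Disjoint (s x) (s y)) (a : κ → α) :
    ∃ d : ι → α, ∀ x, ∀ i ∈ s x, d i = a x := by
  classical
  refine ⟨fun i => if h : ∃ x, i ∈ s x then a h.choose else Classical.arbitrary α,
    fun x i hi => ?_⟩
  have h : ∃ x, i ∈ s x := ⟨x, hi⟩
  have hx : h.choose = x := hs.eq fun hdisj => Finset.disjoint_left.1 hdisj h.choose_spec hi
  exact (dif_pos h).trans (congrArg a hx)

section Recurrence

variable {ι : Type*} [DecidableEq ι] {m : ℕ} {I : Fin m → WeightedSet ι} {k : ℕ}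
  {kx : Fin m → ℕ} {inner : ∀ x, Scheme (I x)} {outer : ∀ v : WeightedSet ι, Scheme v} {τ : ℝ}

theorem WeightedSet.thresholdSum_union
    (hI : Pairwise fun x y => Disjoint (I x).items (I y).items) {v : Fin m → WeightedSet ι}
    (hv : ∀ x, (v x).items ⊆ (I x).items) (τ : ℝ) :
    (WeightedSet.union v).thresholdSum τ = ∑ x, (v x).thresholdSum τ := by
  refine (Finset.sum_biUnion fun x _ y _ hxy => (hI hxy).mono (hv x) (hv y)).trans ?_
  refine Finset.sum_congr rfl fun x _ => Finset.sum_congr rfl fun i hi => ?_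
  rw [WeightedSet.union_weight hI hv (hv x hi)]

theorem IsThreshold.le_of_union (hI : Pairwise fun x y => Disjoint (I x).items (I y).items)
    (hτ : IsThreshold k (WeightedSet.union I) τ) {x : Fin m} {n : ℕ} (hkn : k ≤ n) {σ : ℝ}
    (hσ : IsThreshold n (I x) σ) : σ ≤ τ := by
  refine hσ.le_of_thresholdSum_le hτ.nonneg ?_
  calc (I x).thresholdSum τ ≤ ∑ y, (I y).thresholdSum τ :=
        Finset.single_le_sum (fun y _ => (I y).thresholdSum_nonneg τ) (Finset.mem_univ x)
    _ = (min k (WeightedSet.union I).items.card : ℕ) := by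
        rw [← WeightedSet.thresholdSum_union hI fun _ => subset_rfl, hτ.thresholdSum_eq]
    _ ≤ n := Nat.cast_le.2 ((min_le_left _ _).trans hkn)

theorem thresholdSum_eq_of_mem_support_innerUnion
    (hI : Pairwise fun x y => Disjoint (I x).items (I y).items) {σ : Fin m → ℝ}
    (hσ : ∀ x, IsThreshold (kx x) (I x) (σ x))
    (hinner : ∀ x, (inner x).HorvitzThompson fun i => max ((I x).weight i) (σ x))
    (hsize : ∀ x, (inner x).AtMost (kx x)) (hστ : ∀ x, σ x ≤ τ) {v : WeightedSet ι}
    (hv : v ∈ (innerUnion inner).law.support) :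
    v.thresholdSum τ = (WeightedSet.union I).thresholdSum τ := by
  obtain ⟨f, hf, rfl⟩ := mem_support_innerUnion hv
  rw [WeightedSet.thresholdSum_union hI fun x => (inner x).subset _ (hf x),
    WeightedSet.thresholdSum_union hI fun _ => subset_rfl]
  exact Finset.sum_congr rfl fun x _ => (hinner x).thresholdSum_eq (hστ x) (hf x)
    ((hinner x).card_eq (hσ x) (hsize x) (hf x))

theorem exists_horvitzThompson_innerUnion_outer
    (hI : Pairwise fun x y => Disjoint (I x).items (I y).items) (hk : 1 ≤ k)
    (hkx : ∀ x, k ≤ kx x) (hinner : ∀ x, (inner x).Ipps (kx x))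
    (hsize : ∀ x, (inner x).AtMost (kx x))
    (houter : ∀ v ∈ (innerUnion inner).law.support, (outer v).Ipps k) :
    ∃ τ, IsThreshold k (WeightedSet.union I) τ ∧ ∃ s : ι → ℝ,
      (∀ i ∈ (WeightedSet.union I).items, s i ≤ τ) ∧
      ((innerUnion inner).HorvitzThompson fun i => max ((WeightedSet.union I).weight i) (s i)) ∧
      ∀ v ∈ (innerUnion inner).law.support,
        (outer v).HorvitzThompson fun i => max ((WeightedSet.union I).weight i) τ := by
  obtain ⟨τ, hτ⟩ := exists_isThreshold hk (WeightedSet.union I)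
  choose σ hσ hHT using fun x => Scheme.ipps_iff.1 (hinner x)
  have hστ (x : Fin m) : σ x ≤ τ := hτ.le_of_union hI (hkx x) (hσ x)
  obtain ⟨s, hs⟩ := exists_eq_on_parts hI σ
  have hsτ : ∀ i ∈ (WeightedSet.union I).items, s i ≤ τ := fun i hi => by
    obtain ⟨x, hx⟩ := WeightedSet.mem_union.1 hi
    exact (hs x i hx).trans_le (hστ x)
  have hunion : (innerUnion inner).HorvitzThompson
      fun i => max ((WeightedSet.union I).weight i) (s i) :=
    .innerUnion hI fun x => (hHT x).congr fun i hi => by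
      rw [WeightedSet.union_weight hI (fun _ => subset_rfl) hi, hs x i hi]
  refine ⟨τ, hτ, s, hsτ, hunion, fun v hv => ?_⟩
  have hsum := thresholdSum_eq_of_mem_support_innerUnion hI hσ hHT hsize hστ hv
  have hsub := (innerUnion inner).subset v hv
  exact ((houter v hv).horvitzThompson_of_thresholdSum_eq hτ hsub hsum).congr fun i hi => by
    rw [hunion.weight_eq v hv i hi, max_assoc, max_eq_right (hsτ i (hsub hi))]

namespace Scheme

theorem Ipps.resulting (hI : Pairwise fun x y => Disjoint (I x).items (I y).items) (hk : 1 ≤ k)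
    (hkx : ∀ x, k ≤ kx x) (hinner : ∀ x, (inner x).Ipps (kx x))
    (hsize : ∀ x, (inner x).AtMost (kx x))
    (houter : ∀ v ∈ (innerUnion inner).law.support, (outer v).Ipps k) :
    (VarOpt.resulting inner outer).Ipps k := by
  obtain ⟨τ, hτ, s, -, hunion, hstage⟩ :=
    exists_horvitzThompson_innerUnion_outer hI hk hkx hinner hsize houter
  exact ipps_iff.2 ⟨τ, hτ, hunion.comp
    (fun i hi => lt_max_of_lt_left ((WeightedSet.union I).weight_pos i hi)) hstage⟩

theorem HighOrder.resulting (hI : Pairwise fun x y => Disjoint (I x).items (I y).items)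
    (hk : 1 ≤ k) (hkx : ∀ x, k ≤ kx x) (hinner : ∀ x, (inner x).Ipps (kx x))
    (hsize : ∀ x, (inner x).AtMost (kx x)) (hinner_high : ∀ x, (inner x).HighOrder)
    (houter : ∀ v ∈ (VarOpt.innerUnion inner).law.support, (outer v).Ipps k)
    (houter_high : ∀ v ∈ (VarOpt.innerUnion inner).law.support, (outer v).HighOrder) :
    (VarOpt.resulting inner outer).HighOrder := by
  obtain ⟨τ, -, s, hsτ, hunion, hstage⟩ :=
    exists_horvitzThompson_innerUnion_outer hI hk hkx hinner hsize houter
  refine HighOrder.comp (.innerUnion hI hinner_high) houter_high (fun i hi => ?_)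
    fun v hv i hi => hunion.incl_second_stage hv (hstage v hv) hi
  have hpos : 0 < max ((WeightedSet.union I).weight i) τ :=
    lt_max_of_lt_left ((WeightedSet.union I).weight_pos i hi)
  exact ENNReal.ofReal_le_one.2 ((div_le_one hpos).2 (max_le_max_left _ (hsτ i hi)))

theorem IsVarOpt.resulting (hI : Pairwise fun x y => Disjoint (I x).items (I y).items)
    (hk : 1 ≤ k) (hkx : ∀ x, k ≤ kx x) (hinner : ∀ x, (inner x).IsVarOpt (kx x))
    (houter : ∀ v ∈ (innerUnion inner).law.support, (outer v).IsVarOpt k) :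
    (VarOpt.resulting inner outer).IsVarOpt k where
  unbiased := .comp (.innerUnion hI fun x => (hinner x).unbiased)
    fun v hv => (houter v hv).unbiased
  ipps := .resulting hI hk hkx (fun x => (hinner x).ipps) (fun x => (hinner x).atMost)
    fun v hv => (houter v hv).ipps
  atMost := .comp fun v hv => (houter v hv).atMost
  nonposCov := .comp (.innerUnion hI (fun x => (hinner x).unbiased) fun x => (hinner x).nonposCov)
    (.innerUnion hI fun x => (hinner x).unbiased)
    (fun v hv => (houter v hv).nonposCov) fun v hv => (houter v hv).unbiased

end Scheme

end Recurrence

end VarOpt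

end

/-- The recurrence `VarOpt_k (⋃ I_x) = VarOpt_k (⋃ VarOpt_{k_x} (I_x))`. The outer scheme is only
required to have the respective properties on the inputs that the inner calls can produce. -/
theorem mainTheorem1 {ι : Type*} [DecidableEq ι] {m : ℕ} (I : Fin m → VarOpt.WeightedSet ι)
    (hI : Pairwise fun x y => Disjoint (I x).items (I y).items)
    (k : ℕ) (hk : 1 ≤ k) (kx : Fin m → ℕ) (hkx : ∀ x, k ≤ kx x)
    (inner : ∀ x, VarOpt.Scheme (I x)) (outer : ∀ v : VarOpt.WeightedSet ι, VarOpt.Scheme v) :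
    -- unbiasedness is preserved
    ((∀ x, (inner x).Unbiased) →
      (∀ v ∈ (VarOpt.innerUnion inner).law.support, (outer v).Unbiased) →
      (VarOpt.resulting inner outer).Unbiased) ∧
    -- (iii) is preserved by unbiased schemes
    ((∀ x, (inner x).Unbiased ∧ (inner x).NonposCov) →
      (∀ v ∈ (VarOpt.innerUnion inner).law.support, (outer v).Unbiased ∧ (outer v).NonposCov) →
      (VarOpt.resulting inner outer).NonposCov) ∧
    -- (i) and (ii) for the inner calls and (i) for the outer call give (i)
    ((∀ x, (inner x).Ipps (kx x) ∧ (inner x).AtMost (kx x)) →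
      (∀ v ∈ (VarOpt.innerUnion inner).law.support, (outer v).Ipps k) →
      (VarOpt.resulting inner outer).Ipps k) ∧
    -- unbiasedness with (i)-(iii) is preserved
    ((∀ x, (inner x).IsVarOpt (kx x)) →
      (∀ v ∈ (VarOpt.innerUnion inner).law.support, (outer v).IsVarOpt k) →
      (VarOpt.resulting inner outer).IsVarOpt k) ∧
    -- unbiasedness with (i)-(iii) and (iii+) is preserved
    ((∀ x, (inner x).IsVarOptPlus (kx x)) →
      (∀ v ∈ (VarOpt.innerUnion inner).law.support, (outer v).IsVarOptPlus k) →
      (VarOpt.resulting inner outer).IsVarOptPlus k) := by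
  refine ⟨fun hinner houter => ?_, fun hinner houter => ?_, fun hinner houter => ?_,
    fun hinner houter => ?_, fun hinner houter => ?_⟩
  · exact .comp (.innerUnion hI hinner) houter
  · exact .comp (.innerUnion hI (fun x => (hinner x).1) fun x => (hinner x).2)
      (.innerUnion hI fun x => (hinner x).1) (fun v hv => (houter v hv).2)
      fun v hv => (houter v hv).1
  · exact .resulting hI hk hkx (fun x => (hinner x).1) (fun x => (hinner x).2) houter
  · exact .resulting hI hk hkx hinner houter
  · exact ⟨.resulting hI hk hkx (fun x => (hinner x).toIsVarOpt)
      fun v hv => (houter v hv).toIsVarOpt,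
      .resulting hI hk hkx (fun x => (hinner x).ipps) (fun x => (hinner x).atMost)
        (fun x => (hinner x).highOrder) (fun v hv => (houter v hv).ipps)
        fun v hv => (houter v hv).highOrder⟩
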